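/- Call a field extension $F\subseteq L$ *radical* if $L=F[\alpha]$ for some $\alpha\in L$ with $\alpha^n\in F$ for some integer $n\ge 1$, and a *repeated radical extension* if there are intermediate fields $F=L_0\subseteq L_1\subseteq\cdots\subseteq L_r=L$ with $r \ge 0$ such that each $L_i$ is a radical extension of $L_{i-1}$ for $0<i\le r$. Call a field *quasireal* if it has characteristic zero and its only roots of unity are $\pm1$. Theorem 8.1 (contains Theorem D). Let $Q$ be any field (not necessarily the rational numbers) and let $Q\subseteq L$ be a repeated radical extension. (1) If $L$ is quasireal and $[L:Q]=p^k$ for some prime $p$ and some integer $k\ge 0$, then every field $K$ with $Q\subseteq K\subseteq L$ is a repeated radical extension of $Q$. (2) In particular, if $L$ is real (isomorphic to a subfield of $\mathbb R$) and $[L:Q]=2^k$ for some integer $k\ge0$, then every field $K$ with $Q\subseteq K\subseteq L$ is a repeated radical extension of $Q$. -/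

import Mathlib

/-- `L / F` is a radical extension: `L = F[α]` for some `α ∈ L` having a positive power in `F`.
(Such an `α` is algebraic over `F`, so the ring `F[α]` is the field `F⟮α⟯`.) -/
def IsRadicalExtension (F L : Type*) [Field F] [Field L] [Algebra F L] : Prop :=
  ∃ α : L, (∃ n : ℕ, 0 < n ∧ α ^ n ∈ (algebraMap F L).range) ∧
    IntermediateField.adjoin F {α} = ⊤

/-- `L / F` is a repeated radical extension: there is a tower
`F = C 0 ⊆ C 1 ⊆ ⋯ ⊆ C r = L` of intermediate fields in which each field is a radical
extension of the previous one. Here `IntermediateField.extendScalars h` is the upper field,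
regarded as an extension of the lower one. -/
def IsRepeatedRadicalExtension (F L : Type*) [Field F] [Field L] [Algebra F L] : Prop :=
  ∃ (r : ℕ) (C : Fin (r + 1) → IntermediateField F L),
    C 0 = ⊥ ∧ C (Fin.last r) = ⊤ ∧
      ∀ i : Fin r, ∃ h : C i.castSucc ≤ C i.succ,
        IsRadicalExtension (C i.castSucc) (IntermediateField.extendScalars h)

/-- A field is quasireal if it has characteristic zero and its only roots of unity are `±1`. -/
def IsQuasireal (L : Type*) [Field L] : Prop :=
  CharZero L ∧ ∀ (x : L) (n : ℕ), 0 < n → x ^ n = 1 → x = 1 ∨ x = -1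

/-- A field is real if it is (isomorphic to) a subfield of the real numbers. -/
def IsRealField (L : Type*) [Field L] : Prop :=
  Nonempty (L →+* ℝ)

/-! ### Group theory: chains of subgroups cut out by twisted cocycles. -/

section CocycleChains

variable {G : Type*} [Group G] {p : ℕ}

/-! Since `L` is quasireal of degree `p ^ k`, only `p`-th roots matter: a root of prime exponent `q
≠ p` lying outside a field would have degree `q` over it. Put `L` in a finite Galois extension `E`
generated by the conjugates of `L` and a primitive `p`-th root of unity, with group `G` and mod `p`
cyclotomic character `ω`. Adjoining a `p`-th root yields a subgroup that is the zero set of a Kummer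
cocycle (`IsPowStep.isCocycleStep`); conversely Hilbert 90 turns such zero sets into radical steps
(`IsCocycleStep.isRadicalStep`).

It remains to show: if cocycle steps join `U = Gal(E/L)` to `G`, they join every `V ≥ U` to `G`. Two
facts make this work: `ω.ker` is a `p`-group, and `U` maps onto the image of `ω`, its index being
prime to `p - 1`.

The core is `IsCocycleStep.reflTransGen_of_ge`. A `U`-eigenvector among the homomorphisms from `W ⊓
ω.ker` to `ZMod p` killing `V ⊓ ω.ker` extends to a twisted cocycle on `W` whose zero set `V₁`
contains `V`. Comparison with the given chain, as in Jordan-Hölder, shows that the twist is `ω`. -/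

/-- `V < W` and `V` is the zero set of a `1`-cocycle on `W` with values in `ZMod p` twisted by
the character `ω`. -/
def IsCocycleStep (ω : G →* (ZMod p)ˣ) (V W : Subgroup G) : Prop :=
  V < W ∧ ∃ c : G → ZMod p, (∀ x ∈ W, ∀ y ∈ W, c (x * y) = c x + ω x * c y) ∧
    ∀ x ∈ W, x ∈ V ↔ c x = 0

theorem IsCocycleStep.le_of_reflTransGen {ω : G →* (ZMod p)ˣ} {U W : Subgroup G}
    (h : Relation.ReflTransGen (IsCocycleStep ω) U W) : U ≤ W := by
  induction h with
  | refl => exact le_rfl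
  | tail _ h ih => exact ih.trans h.1.le

-- Intersecting the chain with `V` suffices: cocycles restrict to subgroups, and steps that become
-- equalities are dropped.
open Relation in
theorem IsCocycleStep.reflTransGen_of_le {ω : G →* (ZMod p)ˣ} {U W : Subgroup G}
    (h : ReflTransGen (IsCocycleStep ω) U W) :
    ∀ V : Subgroup G, U ≤ V → V ≤ W → ReflTransGen (IsCocycleStep ω) U V := by
  induction h with
  | refl => intro V h1 h2; rw [le_antisymm h2 h1]
  | @tail X W hUX hXW ih =>
    intro V h1 h2
    by_cases hVX : V ≤ X
    · exact ih V h1 hVX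
    · have hUX' : U ≤ X := IsCocycleStep.le_of_reflTransGen hUX
      obtain ⟨hlt, c, hc, hz⟩ := hXW
      refine (ih (V ⊓ X) (le_inf h1 hUX') inf_le_right).tail
        ⟨lt_of_le_of_ne inf_le_left fun h => hVX (inf_eq_left.1 h), c,
          fun x hx y hy => hc x (h2 hx) y (h2 hy), fun x hx => ?_⟩
      rw [← hz x (h2 hx), Subgroup.mem_inf]
      exact ⟨fun h => h.2, fun h => ⟨hx, h⟩⟩

/-- A proper subgroup of a finite `p`-group lies in the kernel of a nonzero homomorphism to
`ZMod p`. -/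
theorem IsPGroup.exists_hom_zmod {H : Type*} [Group H] [Finite H] [hp : Fact p.Prime]
    (hH : IsPGroup p H) (D : Subgroup H) (hD : D ≠ ⊤) :
    ∃ f : H →* Multiplicative (ZMod p), D ≤ f.ker ∧ f ≠ 1 := by
  obtain ⟨M, hM, hDM⟩ := (eq_top_or_exists_le_coatom D).resolve_left hD
  have : Group.IsNilpotent H := hH.isNilpotent
  have : M.Normal := Subgroup.NormalizerCondition.normal_of_coatom M Group.normalizerCondition_of_isNilpotent hM
  have hq : IsPGroup p (H ⧸ M) := hH.to_quotient M
  have : Nontrivial (H ⧸ M) := QuotientGroup.nontrivial_iff.2 hM.1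
  obtain ⟨x, hx⟩ : ∃ x : H ⧸ M, orderOf x = p := by
    obtain ⟨n, hn0, hn⟩ := (hq.nontrivial_iff_card).1 inferInstance
    exact exists_prime_orderOf_dvd_card' p (hn ▸ dvd_pow_self p hn0.ne')
  have hx1 : x ≠ 1 := fun h => hp.out.one_lt.ne' (by rw [← hx, h, orderOf_one])
  -- The preimage of the subgroup generated by `x` strictly contains the maximal subgroup `M`.
  have htop : Subgroup.zpowers x = ⊤ := by
    have h1 : M < (Subgroup.zpowers x).comap (QuotientGroup.mk' M) := by
      refine lt_of_le_of_ne (fun m hm => ?_) fun h => hx1 ?_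
      · rw [Subgroup.mem_comap, QuotientGroup.mk'_apply, (QuotientGroup.eq_one_iff m).2 hm]
        exact one_mem _
      · obtain ⟨y, rfl⟩ := QuotientGroup.mk'_surjective M x
        exact (QuotientGroup.eq_one_iff y).2
          (h ▸ Subgroup.mem_comap.2 (Subgroup.mem_zpowers _))
    have h2 := hM.2 _ h1
    rw [eq_top_iff]
    intro y _
    obtain ⟨z, rfl⟩ := QuotientGroup.mk'_surjective M y
    exact Subgroup.mem_comap.1 (h2 ▸ Subgroup.mem_top z)
  have hcard : Nat.card (H ⧸ M) = p := by
    rw [← hx, ← Nat.card_zpowers, htop, Subgroup.card_top]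
  let e : H ⧸ M ≃* Multiplicative (ZMod p) :=
    mulEquivOfPrimeCardEq (p := p) hcard (by simp)
  refine ⟨e.toMonoidHom.comp (QuotientGroup.mk' M), fun d hd => ?_, fun h => hM.1 ?_⟩
  · rw [MonoidHom.mem_ker]
    have : (QuotientGroup.mk' M) d = 1 := (QuotientGroup.eq_one_iff d).2 (hDM hd)
    rw [MonoidHom.comp_apply, this, map_one]
  · rw [eq_top_iff]
    intro y _
    have h1 := DFunLike.congr_fun h y
    rw [MonoidHom.comp_apply, MonoidHom.one_apply] at h1
    exact (QuotientGroup.eq_one_iff y).1 ((MulEquiv.map_eq_one_iff e).1 h1)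

/-- A linear endomorphism over `ZMod p` whose `p - 1`-st power is the identity has an
eigenvector. -/
theorem Module.End.exists_eigenvector_of_pow_eq_one {Y : Type*} [hp : Fact p.Prime]
    [AddCommGroup Y] [Module (ZMod p) Y] [Nontrivial Y] (S : Module.End (ZMod p) Y)
    (hS : S ^ (p - 1) = 1) : ∃ (a : ZMod p) (y : Y), y ≠ 0 ∧ S y = a • y := by
  have hmonic : (Polynomial.X ^ p - Polynomial.X : Polynomial (ZMod p)).Monic :=
    Polynomial.monic_X_pow_sub (by
      rw [Polynomial.degree_X]; exact_mod_cast hp.out.one_lt)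
  have hsplits := FiniteField.splits_X_pow_card_sub_X (K := ZMod p) (p := p)
  rw [ZMod.card, Algebra.algebraMap_self, Polynomial.map_id] at hsplits
  have hprod := hsplits.eq_prod_roots_of_monic hmonic
  by_contra! hcon
  -- Without eigenvectors every `S - a` is injective, hence so is their product over the roots of `X
  -- ^ p - X`; but `S ^ p = S`.
  have hinj : ∀ s : Multiset (ZMod p), ∀ y : Y, y ≠ 0 →
      Polynomial.aeval S (s.map fun a => Polynomial.X - Polynomial.C a).prod y ≠ 0 := by
    intro s
    induction s using Multiset.induction_on with
    | empty => intro y hy; simpa using hy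
    | cons a s ih =>
      intro y hy
      rw [Multiset.map_cons, Multiset.prod_cons, mul_comm, map_mul, Module.End.mul_apply]
      refine ih _ ?_
      simpa [sub_eq_zero] using hcon a y hy
  obtain ⟨y, hy⟩ := exists_ne (0 : Y)
  refine hinj (Polynomial.X ^ p - Polynomial.X : Polynomial (ZMod p)).roots y hy ?_
  have hSp : S ^ p = S := by
    rw [← mul_pow_sub_one hp.out.ne_zero, hS, mul_one]
  rw [← hprod, map_sub, map_pow, Polynomial.aeval_X, hSp, sub_self, LinearMap.zero_apply]

/-- If `V < W` contains a supplement `U` to the normal `p`-subgroup `ω.ker`, then `W ⊓ ω.ker`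
has a nonzero homomorphism to `ZMod p` that vanishes on `V ⊓ ω.ker` and that is an eigenvector
for the conjugation action of `U`. -/
theorem exists_eigen_hom [Finite G] [hp : Fact p.Prime] (ω : G →* (ZMod p)ˣ)
    (hker : IsPGroup p ω.ker) {U V W : Subgroup G} (hU : ∀ g, ∃ u ∈ U, ω u = ω g)
    (hUV : U ≤ V) (hVW : V < W) :
    ∃ f : G → ZMod p, (∀ x ∈ W ⊓ ω.ker, ∀ y ∈ W ⊓ ω.ker, f (x * y) = f x + f y) ∧
      (∀ x ∈ V ⊓ ω.ker, f x = 0) ∧ (∃ x ∈ W ⊓ ω.ker, f x ≠ 0) ∧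
      ∀ u ∈ U, ∃ l : ZMod p, ∀ x ∈ W ⊓ ω.ker, f (u * x * u⁻¹) = l * f x := by
  classical
  -- Extension by zero off `W ⊓ ω.ker` realizes the space of homomorphisms inside `G → ZMod p`.
  let Y : Submodule (ZMod p) (G → ZMod p) :=
    { carrier := {f | (∀ x ∈ W ⊓ ω.ker, ∀ y ∈ W ⊓ ω.ker, f (x * y) = f x + f y) ∧
        (∀ x ∈ V ⊓ ω.ker, f x = 0) ∧ ∀ x ∉ W ⊓ ω.ker, f x = 0}
      add_mem' := by
        rintro f g ⟨h1, h2, h3⟩ ⟨k1, k2, k3⟩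
        refine ⟨fun x hx y hy => ?_, fun x hx => ?_, fun x hx => ?_⟩
        · simp only [Pi.add_apply, h1 x hx y hy, k1 x hx y hy]; ring
        · simp [h2 x hx, k2 x hx]
        · simp [h3 x hx, k3 x hx]
      zero_mem' := by simp
      smul_mem' := by
        rintro a f ⟨h1, h2, h3⟩
        refine ⟨fun x hx y hy => ?_, fun x hx => ?_, fun x hx => ?_⟩
        · simp only [Pi.smul_apply, h1 x hx y hy, smul_add]
        · simp [h2 x hx]
        · simp [h3 x hx] }
  have hUW : U ≤ W := hUV.trans hVW.le
  have hconj : ∀ u ∈ U, ∀ x, u * x * u⁻¹ ∈ W ⊓ ω.ker ↔ x ∈ W ⊓ ω.ker := by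
    intro u hu x
    have hu' := hUW hu
    rw [Subgroup.mem_inf, Subgroup.mem_inf, MonoidHom.mem_ker, MonoidHom.mem_ker,
      Subgroup.mul_mem_cancel_right W (inv_mem hu'), Subgroup.mul_mem_cancel_left W hu']
    simp
  have hconjV : ∀ u ∈ U, ∀ x ∈ V ⊓ ω.ker, u * x * u⁻¹ ∈ V ⊓ ω.ker := by
    rintro u hu x ⟨hx, hx'⟩
    refine Subgroup.mem_inf.2 ⟨mul_mem (mul_mem (hUV hu) hx) (inv_mem (hUV hu)), ?_⟩
    exact (inferInstance : ω.ker.Normal).conj_mem x hx' u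
  -- the quotient of `U` by `U ⊓ ω.ker` is cyclic
  obtain ⟨⟨_, g, hgU, rfl⟩, hg⟩ := IsCyclic.exists_generator (α := U.map ω)
  let S : (G → ZMod p) →ₗ[ZMod p] (G → ZMod p) :=
    LinearMap.funLeft (ZMod p) (ZMod p) fun x => g * x * g⁻¹
  have hSY : ∀ f ∈ Y, S f ∈ Y := by
    rintro f ⟨h1, h2, h3⟩
    refine ⟨fun x hx y hy => ?_, fun x hx => h2 _ (hconjV g hgU x hx),
      fun x hx => h3 _ fun h => hx ((hconj g hgU x).1 h)⟩
    change f _ = f _ + f _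
    rw [← h1 _ ((hconj g hgU x).2 hx) _ ((hconj g hgU y).2 hy)]
    congr 1; group
  have hSpow : ∀ (n : ℕ) (f : G → ZMod p) (x : G), (S ^ n) f x = f (g ^ n * x * (g ^ n)⁻¹) := by
    intro n
    induction n with
    | zero => intro f x; simp
    | succ n ih =>
      intro f x
      rw [pow_succ', Module.End.mul_apply]
      change (S ^ n) f (g * x * g⁻¹) = _
      rw [ih]
      congr 1; group
  -- inner automorphisms act trivially
  have hinner : ∀ f ∈ Y, ∀ h ∈ W ⊓ ω.ker, ∀ x ∈ W ⊓ ω.ker, f (h * x * h⁻¹) = f x := by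
    rintro f ⟨h1, h2, h3⟩ h hh x hx
    have e := h1 (h * x * h⁻¹) (mul_mem (mul_mem hh hx) (inv_mem hh)) h hh
    rw [inv_mul_cancel_right, h1 h hh x hx, add_comm] at e
    exact (add_right_cancel e).symm
  have hrestr : (S.restrict hSY) ^ (p - 1) = 1 := by
    refine LinearMap.ext fun f => Subtype.ext (funext fun x => ?_)
    rw [Module.End.pow_restrict, LinearMap.coe_restrict_apply, hSpow, Module.End.one_apply]
    have hmem : g ^ (p - 1) ∈ U := pow_mem hgU _
    by_cases hx : x ∈ W ⊓ ω.ker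
    · refine hinner f.1 f.2 _ (Subgroup.mem_inf.2 ⟨hUW hmem, ?_⟩) x hx
      rw [MonoidHom.mem_ker, map_pow, ZMod.units_pow_card_sub_one_eq_one]
    · rw [f.2.2.2 x hx, f.2.2.2 _ fun h => hx ((hconj _ hmem x).1 h)]
  have hnt : Nontrivial Y := by
    have hP : IsPGroup p ↥(W ⊓ ω.ker) := hker.to_le inf_le_right
    obtain ⟨F, hF, hF1⟩ := hP.exists_hom_zmod ((V ⊓ ω.ker).subgroupOf (W ⊓ ω.ker)) (by
      -- Equality of the two intersections would give `W ≤ V`, because `U ≤ V` supplements `ω.ker`.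
      intro h
      rw [Subgroup.subgroupOf_eq_top] at h
      refine hVW.not_ge fun w hw => ?_
      obtain ⟨u, hu, huw⟩ := hU w
      have : w * u⁻¹ ∈ W ⊓ ω.ker := Subgroup.mem_inf.2 ⟨mul_mem hw (inv_mem (hUW hu)), by
        rw [MonoidHom.mem_ker, map_mul, map_inv, huw, mul_inv_cancel]⟩
      simpa using mul_mem (h this).1 (hUV hu))
    obtain ⟨x, hx⟩ : ∃ x, F x ≠ 1 := by
      by_contra! h
      exact hF1 (MonoidHom.ext h)
    let f : G → ZMod p := fun x => if h : x ∈ W ⊓ ω.ker then (F ⟨x, h⟩).toAdd else 0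
    have hf : f ∈ Y := by
      refine ⟨fun x hx y hy => ?_, fun x hx => ?_, fun x hx => dif_neg hx⟩
      · simp only [f, dif_pos hx, dif_pos hy, dif_pos (mul_mem hx hy)]
        rw [← toAdd_mul, ← map_mul]
        rfl
      · have hxW : x ∈ W ⊓ ω.ker := ⟨hVW.le hx.1, hx.2⟩
        have h1 : F ⟨x, hxW⟩ = 1 := hF (Subgroup.mem_subgroupOf.2 hx)
        simp only [f, dif_pos hxW, h1, toAdd_one]
    refine ⟨⟨f, hf⟩, 0, fun h => hx ?_⟩
    have h1 : f x = 0 := congrFun (congrArg Subtype.val h) x.1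
    simp only [f, dif_pos x.2] at h1
    exact toAdd_eq_zero.1 h1
  obtain ⟨a, ⟨f, hfY⟩, hf0, hfa⟩ := Module.End.exists_eigenvector_of_pow_eq_one _ hrestr
  have hSf : S f = a • f := congrArg Subtype.val hfa
  have hSnf : ∀ n : ℕ, (S ^ n) f = a ^ n • f := by
    intro n
    induction n with
    | zero => simp
    | succ n ih => rw [pow_succ, Module.End.mul_apply, hSf, map_smul, ih, smul_smul, pow_succ']
  refine ⟨f, hfY.1, hfY.2.1, ?_, fun u hu => ?_⟩
  · by_contra! h
    refine hf0 (Subtype.ext (funext fun x => ?_))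
    by_cases hx : x ∈ W ⊓ ω.ker
    · exact h x hx
    · exact hfY.2.2 x hx
  -- Modulo `W ⊓ ω.ker`, which acts trivially, `u` is a power of `g`; so one eigenvector for `g`
  -- serves all of `U`.
  · obtain ⟨n, hn⟩ := (mem_powers_iff_mem_zpowers.2 (hg ⟨ω u, u, hu, rfl⟩))
    have hn' : ω g ^ n = ω u := congrArg Subtype.val hn
    refine ⟨a ^ n, fun x hx => ?_⟩
    have hgn : g ^ n ∈ U := pow_mem hgU n
    have h1 : u * (g ^ n)⁻¹ ∈ W ⊓ ω.ker := Subgroup.mem_inf.2 ⟨hUW (mul_mem hu (inv_mem hgn)), by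
      rw [MonoidHom.mem_ker, map_mul, map_inv, map_pow, hn', mul_inv_cancel]⟩
    have h2 := hinner f hfY _ h1 _ ((hconj _ hgn x).2 hx)
    rw [← hSpow n f x, hSnf] at h2
    refine Eq.trans (congrArg f ?_) h2
    group

/-- A subgroup between the zero set `V` of a cocycle on `W` and `W` is one of the two, if it
contains a supplement to `ω.ker`. -/
theorem IsCocycleStep.eq_of_le_of_lt [hp : Fact p.Prime] {ω : G →* (ZMod p)ˣ} {U V Y W : Subgroup G}
    (hU : ∀ g, ∃ u ∈ U, ω u = ω g) (hUV : U ≤ V) (h : IsCocycleStep ω V W) (hVY : V ≤ Y)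
    (hYW : Y < W) : Y = V := by
  obtain ⟨hlt, c, hc, hz⟩ := h
  refine le_antisymm (fun y hy => by_contra fun hyV => hYW.not_ge fun w hw => ?_) hVY
  have hsupp : ∀ w ∈ W, ∃ x ∈ W, ω x = 1 ∧ ∃ u ∈ U, w = x * u ∧ c w = c x := by
    intro w hw
    obtain ⟨u, hu, huw⟩ := hU w
    have huW := hlt.le (hUV hu)
    have hx : w * u⁻¹ ∈ W := mul_mem hw (inv_mem huW)
    refine ⟨w * u⁻¹, hx, by rw [map_mul, map_inv, huw, mul_inv_cancel], u, hu, by group, ?_⟩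
    have := hc _ hx u huW
    rwa [inv_mul_cancel_right, (hz u huW).1 (hUV hu), mul_zero, add_zero] at this
  obtain ⟨x, hxW, hx1, u, hu, rfl, hcx⟩ := hsupp y (hYW.le hy)
  have hxY : x ∈ Y := by simpa using mul_mem hy (inv_mem (hVY (hUV hu)))
  rw [hz _ (hYW.le hy), hcx] at hyV
  have hpow : ∀ n : ℕ, c (x ^ n) = n * c x := by
    intro n
    induction n with
    | zero =>
      rw [pow_zero, Nat.cast_zero, zero_mul]
      exact (hz 1 (one_mem W)).1 (one_mem V)
    | succ n ih =>
      rw [pow_succ, hc _ (pow_mem hxW n) x hxW, ih, map_pow, hx1]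
      push_cast
      simp
      ring
  -- As `ω x = 1`, `c` is additive on powers of `x`; the exponent is chosen to cancel `c w`.
  have hmem : x ^ (-(c w) / c x).val * w ∈ V := by
    rw [hz _ (mul_mem (pow_mem hxW _) hw), hc _ (pow_mem hxW _) w hw, hpow, map_pow, hx1,
      ZMod.natCast_zmod_val, div_mul_cancel₀ _ hyV]
    simp
  exact (Subgroup.mul_mem_cancel_left Y (pow_mem hxY _)).1 (hVY hmem)

open Relation in
/-- If `U` is joined to `W` by a chain of cocycle steps, then so is every subgroup between them:
the refinement argument is that of the Jordan-Hölder theorem. -/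
theorem IsCocycleStep.reflTransGen_of_ge [Finite G] [hp : Fact p.Prime] {ω : G →* (ZMod p)ˣ}
    (hker : IsPGroup p ω.ker) {U : Subgroup G} (hU : ∀ g, ∃ u ∈ U, ω u = ω g) (W : Subgroup G) :
    ReflTransGen (IsCocycleStep ω) U W →
      ∀ V : Subgroup G, U ≤ V → V ≤ W → ReflTransGen (IsCocycleStep ω) V W := by
  induction W using WellFoundedLT.induction with
  | ind W IH =>
  intro hUWc V hUV hVW
  rcases eq_or_lt_of_le hVW with rfl | hVW
  · exact ReflTransGen.refl
  rcases ReflTransGen.cases_tail hUWc with h | ⟨W₁, hUW₁c, hstep⟩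
  · exact absurd (hUV.trans_lt hVW) (h ▸ lt_irrefl _)
  have hUW₁ := IsCocycleStep.le_of_reflTransGen hUW₁c
  have hW₁W := hstep.1
  by_cases hVW₁ : V ≤ W₁
  · exact (IH W₁ hW₁W hUW₁c V hUV hVW₁).tail hstep
  have hUW := hUV.trans hVW.le
  obtain ⟨f, hfadd, hfV, ⟨x₀, hx₀, hfx₀⟩, hfl⟩ := exists_eigen_hom ω hker hU hUV hVW
  have hquot : ∀ x ∈ W, ∀ u ∈ U, ω u = ω x → x * u⁻¹ ∈ W ⊓ ω.ker := fun x hx u hu h =>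
    Subgroup.mem_inf.2 ⟨mul_mem hx (inv_mem (hUW hu)), by
      rw [MonoidHom.mem_ker, map_mul, map_inv, h, mul_inv_cancel]⟩
  have hconj : ∀ u ∈ U, ∀ x ∈ W ⊓ ω.ker, u * x * u⁻¹ ∈ W ⊓ ω.ker := fun u hu x hx =>
    Subgroup.mem_inf.2 ⟨mul_mem (mul_mem (hUW hu) hx.1) (inv_mem (hUW hu)),
      (inferInstance : ω.ker.Normal).conj_mem x hx.2 u⟩
  choose s hsU hsω using hU
  let c : G → ZMod p := fun w => f (w * (s w)⁻¹)
  -- the value does not depend on the choice of the representative in `U`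
  have hc : ∀ w ∈ W, ∀ u ∈ U, ω u = ω w → c w = f (w * u⁻¹) := by
    intro w hw u hu huw
    have h1 : u * (s w)⁻¹ ∈ V ⊓ ω.ker := Subgroup.mem_inf.2
      ⟨hUV (mul_mem hu (inv_mem (hsU w))), by
        rw [MonoidHom.mem_ker, map_mul, map_inv, hsω, huw, mul_inv_cancel]⟩
    have h2 := hfadd _ (hquot w hw u hu huw) _
      (Subgroup.mem_inf.2 ⟨hVW.le (Subgroup.mem_inf.1 h1).1, (Subgroup.mem_inf.1 h1).2⟩)
    rw [hfV _ h1, add_zero] at h2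
    rw [← h2]
    simp only [c]
    congr 1; group
  have hcmul : ∀ x ∈ W, ∀ y ∈ W, ∀ l, (∀ z ∈ W ⊓ ω.ker, f (s x * z * (s x)⁻¹) = l * f z) →
      c (x * y) = c x + l * c y := by
    intro x hx y hy l hl
    have hx' := hquot x hx (s x) (hsU x) (hsω x)
    have hy' := hquot y hy (s y) (hsU y) (hsω y)
    rw [hc _ (mul_mem hx hy) (s x * s y) (mul_mem (hsU x) (hsU y)) (by
      rw [map_mul, map_mul, hsω, hsω])]
    simp only [c]
    rw [← hl _ hy', ← hfadd _ hx' _ (hconj _ (hsU x) _ hy')]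
    congr 1; group
  have hcP : ∀ x ∈ W ⊓ ω.ker, c x = f x := by
    intro x hx
    rw [hc x hx.1 1 (one_mem U) (by rw [map_one]; exact (MonoidHom.mem_ker.1 hx.2).symm)]
    simp
  have hcV : ∀ v ∈ V, c v = 0 := fun v hv => hfV _ (Subgroup.mem_inf.2
    ⟨mul_mem hv (inv_mem (hUV (hsU v))), by
      rw [MonoidHom.mem_ker, map_mul, map_inv, hsω, mul_inv_cancel]⟩)
  let V₁ : Subgroup G :=
    { carrier := {w | w ∈ W ∧ c w = 0}
      mul_mem' := by
        rintro x y ⟨hx, hcx⟩ ⟨hy, hcy⟩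
        obtain ⟨l, hl⟩ := hfl (s x) (hsU x)
        exact ⟨mul_mem hx hy, by rw [hcmul x hx y hy l hl, hcx, hcy]; ring⟩
      one_mem' := ⟨one_mem W, hcV 1 (one_mem V)⟩
      inv_mem' := by
        rintro x ⟨hx, hcx⟩
        obtain ⟨l, hl⟩ := hfl (s x⁻¹) (hsU _)
        have h := hcmul x⁻¹ (inv_mem hx) x hx l hl
        rw [inv_mul_cancel, hcV 1 (one_mem V), hcx, mul_zero, add_zero] at h
        exact ⟨inv_mem hx, h.symm⟩ }
  have hV₁ : ∀ {w}, w ∈ V₁ ↔ w ∈ W ∧ c w = 0 := Iff.rfl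
  have hVV₁ : V ≤ V₁ := fun v hv => ⟨hVW.le hv, hcV v hv⟩
  have hV₁W : V₁ < W := lt_of_le_of_ne (fun w hw => hw.1) fun h =>
    hfx₀ (by rw [← hcP x₀ hx₀]; exact (hV₁.1 (h ▸ hx₀.1)).2)
  have hU' : ∀ g, ∃ u ∈ U, ω u = ω g := fun g => ⟨s g, hsU g, hsω g⟩
  -- `W₁` is maximal among the proper subgroups of `W` containing it, so `W₁ ≤ V₁` would force `V ≤
  -- V₁ = W₁`.
  have hnle : ¬ W₁ ≤ V₁ := fun h => hVW₁ <|
    hVV₁.trans (hstep.eq_of_le_of_lt hU' hUW₁ h hV₁W).le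
  have hXlt : V₁ ⊓ W₁ < W₁ := lt_of_le_of_ne inf_le_right fun h => hnle (inf_eq_right.1 h)
  have hUX : U ≤ V₁ ⊓ W₁ := le_inf (hUV.trans hVV₁) hUW₁
  have hXc := IH W₁ hW₁W hUW₁c _ hUX inf_le_right
  -- the eigenvalues of `f` are those prescribed by `ω`
  have hlω : ∀ u ∈ U, ∀ x ∈ W ⊓ ω.ker, f (u * x * u⁻¹) = ω u * f x := by
    -- The last step of a chain from `V₁ ⊓ W₁` to `W₁` has a cocycle `c'` with twist `ω`. On `W₁ ⊓
    -- ω.ker` it vanishes wherever `f` does and is not zero, so both have the same eigenvalues.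
    obtain ⟨Y, hXY, hYlt, c', hc', hz'⟩ :=
      (ReflTransGen.cases_tail hXc).resolve_left fun h => hXlt.ne h.symm
    have hXY := IsCocycleStep.le_of_reflTransGen hXY
    obtain ⟨w, hw, hwY⟩ := SetLike.exists_of_lt hYlt
    have hx := hquot w (hW₁W.le hw) (s w) (hsU w) (hsω w)
    have hxW₁ : w * (s w)⁻¹ ∈ W₁ := mul_mem hw (inv_mem (hUW₁ (hsU w)))
    have hxY : w * (s w)⁻¹ ∉ Y := fun h => hwY
      ((Subgroup.mul_mem_cancel_right Y (inv_mem (hXY (hUX (hsU w))))).1 h)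
    generalize w * (s w)⁻¹ = x at hx hxW₁ hxY
    have hc'x : c' x ≠ 0 := fun h => hxY ((hz' x hxW₁).2 h)
    have hfc' : ∀ z ∈ W₁, z ∈ W ⊓ ω.ker → f z = 0 → c' z = 0 := fun z hz hzP hfz =>
      (hz' z hz).1 (hXY (Subgroup.mem_inf.2 ⟨⟨hzP.1, (hcP z hzP).trans hfz⟩, hz⟩))
    have hx1 : ω x = 1 := MonoidHom.mem_ker.1 (Subgroup.mem_inf.1 hx).2
    have hf1 : f 1 = 0 := hfV 1 (one_mem _)
    have hc'1 : c' 1 = 0 := hfc' 1 (one_mem _) (one_mem _) hf1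
    have hpow : ∀ n : ℕ, f (x ^ n) = n * f x ∧ c' (x ^ n) = n * c' x := by
      intro n
      induction n with
      | zero => simp [hf1, hc'1]
      | succ n ih =>
        rw [pow_succ, hfadd _ (pow_mem hx n) x hx, hc' _ (pow_mem hxW₁ n) x hxW₁, ih.1, ih.2,
          map_pow, hx1]
        push_cast
        constructor
        · ring
        · simp; ring
    intro u hu
    obtain ⟨l, hl⟩ := hfl u hu
    suffices h : l = ω u by rw [← h]; exact hl
    have huW₁ := hUW₁ hu
    have hzP := hconj u hu x hx
    have hzW₁ : u * x * u⁻¹ ∈ W₁ := mul_mem (mul_mem huW₁ hxW₁) (inv_mem huW₁)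
    have hc'u : ∀ u ∈ U, c' u = 0 := fun u hu => (hz' u (hUW₁ hu)).1 (hXY (hUX hu))
    have h1 : c' (u * x * u⁻¹) = ω u * c' x := by
      rw [hc' _ (mul_mem huW₁ hxW₁) _ (inv_mem huW₁), hc' _ huW₁ _ hxW₁, hc'u u hu,
        hc'u _ (inv_mem hu)]
      ring
    -- The exponent `-l` puts this product in the kernel of `f`; applying `c'` gives `(ω u - l) * c'
    -- x = 0`.
    have h2 := hfc' _ (mul_mem hzW₁ (pow_mem hxW₁ (-l).val)) (mul_mem hzP (pow_mem hx _)) (by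
      rw [hfadd _ hzP _ (pow_mem hx _), hl x hx, (hpow _).1, ZMod.natCast_zmod_val]
      ring)
    rw [hc' _ hzW₁ _ (pow_mem hxW₁ _), h1, (hpow _).2, ZMod.natCast_zmod_val,
      MonoidHom.mem_ker.1 (Subgroup.mem_inf.1 hzP).2, Units.val_one, one_mul, neg_mul,
      ← sub_eq_add_neg, ← sub_mul] at h2
    exact (sub_eq_zero.1 ((mul_eq_zero.1 h2).resolve_right hc'x)).symm
  have hstep₁ : IsCocycleStep ω V₁ W := by
    refine ⟨hV₁W, c, fun x hx y hy => ?_, fun x hx => ⟨fun h => h.2, fun h => ⟨hx, h⟩⟩⟩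
    rw [← hsω x]
    exact hcmul x hx y hy _ (hlω _ (hsU x))
  exact (IH V₁ hV₁W (IsCocycleStep.reflTransGen_of_le hUWc V₁ (hUV.trans hVV₁) hV₁W.le) V hUV
    hVV₁).tail hstep₁

end CocycleChains

/-! ### Field theory: radical towers and reduction to `p`-th roots. -/

section RadicalChains

open Relation IntermediateField

variable {F L : Type*} [Field F] [Field L] [Algebra F L]

/-- `B` is generated over `A` by an element having a positive power in `A`. -/
def IsRadicalStep (A B : IntermediateField F L) : Prop :=
  A ≤ B ∧ ∃ α ∈ B, (∃ n : ℕ, 0 < n ∧ α ^ n ∈ A) ∧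
    ∀ M : IntermediateField F L, A ≤ M → α ∈ M → B ≤ M

/-- `B` is properly generated over `A` by an element with its `p`-th power in `A`. -/
def IsPowStep (p : ℕ) (A B : IntermediateField F L) : Prop :=
  A < B ∧ ∃ α ∈ B, α ^ p ∈ A ∧ ∀ M : IntermediateField F L, A ≤ M → α ∈ M → B ≤ M

/-- Expressing generation by minimality among intermediate fields over the fixed base `F` avoids
changing the base along the tower. -/
theorem isRadicalStep_iff {A B : IntermediateField F L} :
    IsRadicalStep A B ↔ ∃ h : A ≤ B, IsRadicalExtension A (extendScalars h) := by
  constructor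
  · rintro ⟨h, α, hα, ⟨n, hn, hαn⟩, hM⟩
    refine ⟨h, ⟨α, hα⟩, ⟨n, hn, ⟨⟨α ^ n, hαn⟩, rfl⟩⟩, ?_⟩
    let N := ((adjoin A {(⟨α, hα⟩ : extendScalars h)}).map (extendScalars h).val).restrictScalars F
    have hBN : B ≤ N := by
      refine hM N (fun a ha => ?_) ⟨⟨α, hα⟩, subset_adjoin _ _ rfl, rfl⟩
      exact ⟨⟨a, h ha⟩, (adjoin A {(⟨α, hα⟩ : extendScalars h)}).algebraMap_mem ⟨a, ha⟩, rfl⟩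
    rw [eq_top_iff]
    rintro ⟨b, hb⟩ -
    obtain ⟨x, hx, hxb⟩ := hBN hb
    have : x = ⟨b, hb⟩ := Subtype.ext hxb
    exact this ▸ hx
  · rintro ⟨h, ⟨α, hα⟩, ⟨n, hn, ⟨a, ha⟩⟩, htop⟩
    refine ⟨h, α, hα, ⟨n, hn, ?_⟩, fun M hAM hαM b hb => ?_⟩
    · have := congrArg Subtype.val ha
      change (a : L) = α ^ n at this
      exact this ▸ a.2
    · have hle : adjoin A {(⟨α, hα⟩ : extendScalars h)} ≤
          (extendScalars hAM).comap (extendScalars h).val := by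
        rw [adjoin_le_iff, Set.singleton_subset_iff]
        exact hαM
      rw [htop] at hle
      exact hle (x := ⟨b, hb⟩) trivial

theorem isRepeatedRadicalExtension_iff :
    IsRepeatedRadicalExtension F L ↔
      ReflTransGen IsRadicalStep (⊥ : IntermediateField F L) ⊤ := by
  constructor
  · rintro ⟨r, C, h0, hr, hC⟩
    have : ∀ i : Fin (r + 1), ReflTransGen IsRadicalStep ⊥ (C i) := by
      intro i
      induction i using Fin.induction with
      | zero => rw [h0]
      | succ i ih => exact ih.tail (isRadicalStep_iff.2 (hC i))
    exact hr ▸ this (Fin.last r)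
  · intro h
    have key : ∀ B : IntermediateField F L, ReflTransGen IsRadicalStep ⊥ B →
        ∃ (r : ℕ) (C : Fin (r + 1) → IntermediateField F L), C 0 = ⊥ ∧ C (Fin.last r) = B ∧
          ∀ i : Fin r, IsRadicalStep (C i.castSucc) (C i.succ) := by
      intro B hB
      induction hB with
      | refl => exact ⟨0, fun _ => ⊥, rfl, rfl, fun i => i.elim0⟩
      | @tail A B _ hAB ih =>
        obtain ⟨r, C, h0, hr, hC⟩ := ih
        refine ⟨r + 1, Fin.snoc C B, ?_, ?_, fun i => ?_⟩
        · rw [← Fin.castSucc_zero, Fin.snoc_castSucc, h0]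
        · rw [Fin.snoc_last]
        · refine Fin.lastCases ?_ (fun j => ?_) i
          · rw [Fin.snoc_castSucc, hr, Fin.succ_last, Fin.snoc_last]
            exact hAB
          · rw [Fin.snoc_castSucc, ← Fin.castSucc_succ, Fin.snoc_castSucc]
            exact hC j
    obtain ⟨r, C, h0, hr, hC⟩ := key ⊤ h
    exact ⟨r, C, h0, hr, fun i => isRadicalStep_iff.1 (hC i)⟩

/-- A chain of radical steps inside an overfield gives a repeated radical extension. -/
theorem isRepeatedRadicalExtension_of_reflTransGen {K : Type*} [Field K] [Algebra F K]
    (φ : K →ₐ[F] L) (h : ReflTransGen IsRadicalStep ⊥ φ.fieldRange) :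
    IsRepeatedRadicalExtension F K := by
  rw [isRepeatedRadicalExtension_iff]
  have key : ∀ B : IntermediateField F L, ReflTransGen IsRadicalStep ⊥ B → B ≤ φ.fieldRange →
      ReflTransGen IsRadicalStep ⊥ (B.comap φ) := by
    intro B hB
    induction hB with
    | refl =>
      intro _
      have : (⊥ : IntermediateField F L).comap φ = ⊥ := by
        rw [eq_bot_iff]
        rintro x ⟨a, ha⟩
        refine ⟨a, φ.injective ?_⟩
        exact (φ.commutes a).trans ha
      rw [this]
    | @tail A B _ hAB ih =>
      intro hB
      obtain ⟨hle, α, hα, ⟨n, hn, hαn⟩, hM⟩ := hAB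
      refine (ih (hle.trans hB)).tail ?_
      obtain ⟨β, rfl⟩ := hB hα
      refine ⟨fun x hx => hle hx, β, hα, ⟨n, hn, ?_⟩, fun M hAM hβ x hx => ?_⟩
      · change φ (β ^ n) ∈ A
        rw [map_pow]
        exact hαn
      · obtain ⟨y, hy, hyx⟩ := hM (M.map φ) (fun a ha => by
          obtain ⟨b, rfl⟩ := hB (hle ha)
          exact ⟨b, hAM ha, rfl⟩) ⟨β, hβ, rfl⟩ hx
        exact φ.injective hyx ▸ hy
  have := key _ h le_rfl
  have htop : φ.fieldRange.comap φ = ⊤ := by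
    rw [eq_top_iff]
    rintro x -
    exact ⟨x, rfl⟩
  rwa [htop] at this

/-- In a quasireal extension of degree a power of `p`, a root of prime exponent `q ≠ p` is
trivial. -/
theorem mem_of_pow_mem_of_ne [FiniteDimensional F L] (hL : IsQuasireal L) {p k q : ℕ}
    (hp : p.Prime) (hk : Module.finrank F L = p ^ k) (hq : q.Prime) (hqp : q ≠ p)
    (A : IntermediateField F L) {α : L} (hα : α ^ q ∈ A) : α ∈ A := by
  by_contra hαA
  -- A `q`-th root `b` of `α ^ q` in `A` would differ from `α` by a root of unity, hence by a sign.
  have hirr : Irreducible (Polynomial.X ^ q - Polynomial.C (⟨α ^ q, hα⟩ : A)) := by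
    refine X_pow_sub_C_irreducible_of_prime hq fun b hb => hαA ?_
    have hb' : (b : L) ^ q = α ^ q := congrArg Subtype.val hb
    by_cases hb0 : (b : L) = 0
    · rw [hb0, zero_pow hq.ne_zero] at hb'
      rw [eq_zero_of_pow_eq_zero hb'.symm]
      exact zero_mem A
    have h1 : (α / b) ^ q = 1 := by rw [div_pow, ← hb', div_self (pow_ne_zero _ hb0)]
    rcases hL.2 _ q hq.pos h1 with h | h
    · rw [div_eq_iff hb0, one_mul] at h
      exact h ▸ b.2
    · rw [div_eq_iff hb0, neg_one_mul] at h
      exact h ▸ neg_mem b.2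
  have hdvd : q ∣ Module.finrank A L := by
    have hmin := minpoly.eq_of_irreducible_of_monic hirr (x := α) (by
      rw [map_sub, map_pow, Polynomial.aeval_X, Polynomial.aeval_C]
      exact sub_self (α ^ q)) (Polynomial.monic_X_pow_sub_C _ hq.ne_zero)
    have := minpoly.degree_dvd (K := A) (Algebra.IsIntegral.isIntegral α)
    rwa [← hmin, Polynomial.natDegree_X_pow_sub_C] at this
  have h2 : q ∣ p ^ k := by
    rw [← hk, ← Module.finrank_mul_finrank F A L]
    exact hdvd.mul_left _
  exact hqp ((Nat.prime_dvd_prime_iff_eq hq hp).1 (hq.dvd_of_dvd_pow h2))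

/-- Peel one prime `q` off the exponent at a time, adjoining `α ^ q` first. The remaining step to
`α` is trivial unless `q = p`. -/
theorem reflTransGen_isPowStep [FiniteDimensional F L] (hL : IsQuasireal L) {p k : ℕ}
    (hp : p.Prime) (hk : Module.finrank F L = p ^ k) (n : ℕ) :
    0 < n → ∀ (A : IntermediateField F L) (α : L), α ^ n ∈ A →
      ReflTransGen (IsPowStep p) A (A ⊔ adjoin F {α}) := by
  induction n using Nat.strong_induction_on with
  | _ n ih =>
  intro hn A α hα
  have hmem : α ∈ A → A ⊔ adjoin F {α} = A := fun h => by
    rw [sup_eq_left, adjoin_le_iff, Set.singleton_subset_iff]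
    exact h
  have hgen : α ∈ A ⊔ adjoin F {α} :=
    (le_sup_right : _ ≤ A ⊔ adjoin F {α}) (mem_adjoin_simple_self F α)
  rcases eq_or_ne n 1 with rfl | hn1
  · rw [pow_one] at hα
    rw [hmem hα]
  obtain ⟨q, hq, m, rfl⟩ := Nat.exists_prime_and_dvd hn1
  have hm0 : 0 < m := Nat.pos_of_mul_pos_left hn
  have hchain := ih m (lt_mul_of_one_lt_left hm0 hq.one_lt) hm0 A (α ^ q) (by rwa [← pow_mul])
  set M := A ⊔ adjoin F {α ^ q}
  have hMle : M ≤ A ⊔ adjoin F {α} := by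
    refine sup_le le_sup_left ?_
    rw [adjoin_le_iff, Set.singleton_subset_iff]
    exact pow_mem hgen q
  have hle : ∀ N : IntermediateField F L, M ≤ N → α ∈ N → A ⊔ adjoin F {α} ≤ N := by
    intro N hN hαN
    refine sup_le (le_sup_left.trans hN) ?_
    rw [adjoin_le_iff, Set.singleton_subset_iff]
    exact hαN
  have hαM : α ^ q ∈ M := (le_sup_right : _ ≤ M) (mem_adjoin_simple_self F _)
  by_cases h : α ∈ M
  · rwa [le_antisymm (hle M le_rfl h) hMle]
  · have hqp : q = p := by
      by_contra hqp
      exact h (mem_of_pow_mem_of_ne hL hp hk hq hqp M hαM)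
    refine hchain.tail ⟨lt_of_le_of_ne hMle fun e => h (e ▸ hgen), α, hgen, hqp ▸ hαM, hle⟩

/-- A repeated radical extension of degree a power of `p` is obtained by adjoining `p`-th roots
only, if it is quasireal. -/
theorem IsRepeatedRadicalExtension.reflTransGen_isPowStep [FiniteDimensional F L]
    (hL : IsQuasireal L) {p k : ℕ} (hp : p.Prime) (hk : Module.finrank F L = p ^ k)
    (h : IsRepeatedRadicalExtension F L) :
    ReflTransGen (IsPowStep p) (⊥ : IntermediateField F L) ⊤ := by
  rw [isRepeatedRadicalExtension_iff] at h
  generalize (⊤ : IntermediateField F L) = B at h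
  induction h with
  | refl => exact ReflTransGen.refl
  | @tail A B _ hAB ih =>
    obtain ⟨hle, α, hα, ⟨n, hn, hαn⟩, hM⟩ := hAB
    have hB : B = A ⊔ adjoin F {α} := by
      refine le_antisymm (hM _ le_sup_left ?_) (sup_le hle ?_)
      · exact (le_sup_right : _ ≤ A ⊔ adjoin F {α}) (mem_adjoin_simple_self F α)
      · rw [adjoin_le_iff, Set.singleton_subset_iff]
        exact hα
    rw [hB]
    exact ih.trans (_root_.reflTransGen_isPowStep hL hp hk n hn A α hαn)

theorem IsRealField.isQuasireal {L : Type*} [Field L] (h : IsRealField L) : IsQuasireal L := by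
  obtain ⟨φ⟩ := h
  refine ⟨φ.charZero, fun x n hn hx => ?_⟩
  have h1 : |φ x| ^ n = 1 := by rw [← abs_pow, ← map_pow, hx, map_one, abs_one]
  have h2 : |φ x| = 1 := (pow_eq_one_iff_of_nonneg (abs_nonneg _) hn.ne').1 h1
  rcases eq_or_eq_neg_of_abs_eq h2 with h | h
  · exact Or.inl (φ.injective (by rw [h, map_one]))
  · exact Or.inr (φ.injective (by rw [h, map_neg, map_one]))

end RadicalChains

/-! ### Kummer theory: the dictionary between `p`-th roots and cocycles. -/

section KummerCocycles

open Relation IntermediateField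

variable {F E : Type*} [Field F] [Field E] [Algebra F E] {p : ℕ}

theorem IsPrimitiveRoot.pow_val_add {ζ : E} [NeZero p] (hζ : IsPrimitiveRoot ζ p) (a b : ZMod p) :
    ζ ^ (a + b).val = ζ ^ a.val * ζ ^ b.val := by
  rw [ZMod.val_add, ← pow_add]
  exact (pow_eq_pow_mod _ hζ.pow_eq_one).symm

theorem IsPrimitiveRoot.pow_val_mul {ζ : E} [NeZero p] (hζ : IsPrimitiveRoot ζ p) (a b : ZMod p) :
    ζ ^ (a * b).val = (ζ ^ a.val) ^ b.val := by
  rw [ZMod.val_mul, ← pow_mul]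
  exact (pow_eq_pow_mod _ hζ.pow_eq_one).symm

theorem IsPrimitiveRoot.pow_val_inj {ζ : E} [NeZero p] (hζ : IsPrimitiveRoot ζ p)
    {a b : ZMod p} (h : ζ ^ a.val = ζ ^ b.val) : a = b :=
  ZMod.val_injective p (hζ.pow_inj a.val_lt b.val_lt h)

/-- The Kummer cocycle of a `p`-th root. -/
theorem IsPowStep.isCocycleStep [FiniteDimensional F E] [IsGalois F E] [hp : Fact p.Prime]
    {ζ : E} (hζ : IsPrimitiveRoot ζ p) {A B : IntermediateField F E} (h : IsPowStep p A B) :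
    IsCocycleStep (hζ.autToPow F) B.fixingSubgroup A.fixingSubgroup := by
  obtain ⟨hlt, α, hα, hαp, hM⟩ := h
  have hα0 : α ≠ 0 := fun h => hlt.not_ge (hM A le_rfl (h ▸ zero_mem A))
  -- The cocycle is the exponent of `w α / α` as a power of `ζ`; its value off the group of `A` is
  -- irrelevant.
  have hex : ∀ w : E ≃ₐ[F] E, ∃ a : ZMod p, w ∈ A.fixingSubgroup → w α = ζ ^ a.val * α := by
    intro w
    by_cases hw : w ∈ A.fixingSubgroup
    · have h1 : (w α / α) ^ p = 1 := by
        rw [div_pow, ← map_pow, (mem_fixingSubgroup_iff A w).1 hw _ hαp,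
          div_self (pow_ne_zero _ hα0)]
      obtain ⟨i, hi, hi'⟩ := hζ.eq_pow_of_pow_eq_one h1
      refine ⟨i, fun _ => ?_⟩
      rw [ZMod.val_natCast_of_lt hi, hi', div_mul_cancel₀ _ hα0]
    · exact ⟨0, fun h => absurd h hw⟩
  choose c hc using hex
  refine ⟨lt_of_le_of_ne (fixingSubgroup_antitone hlt.le) fun h => hlt.ne ?_, c,
    fun x hx y hy => ?_, fun x hx => ?_⟩
  · rw [← IsGalois.fixedField_fixingSubgroup A, ← h, IsGalois.fixedField_fixingSubgroup]
  · apply hζ.pow_val_inj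
    apply mul_right_cancel₀ hα0
    rw [← hc _ (mul_mem hx hy), AlgEquiv.mul_apply, hc y hy, map_mul, map_pow,
      ← hζ.autToPow_spec F x, hc x hx, hζ.pow_val_add, hζ.pow_val_mul]
    ring
  · constructor
    · intro h
      apply hζ.pow_val_inj
      apply mul_right_cancel₀ hα0
      rw [← hc x hx, (mem_fixingSubgroup_iff B x).1 h α hα, ZMod.val_zero, pow_zero, one_mul]
    · intro h
      have hxα : x α = α := by rw [hc x hx, h, ZMod.val_zero, pow_zero, one_mul]
      rw [← Subgroup.zpowers_le, ← le_iff_le]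
      refine hM _ ((le_iff_le _ _).2 (Subgroup.zpowers_le.2 hx)) ?_
      rw [mem_fixedField_iff]
      intro f hf
      have : Subgroup.zpowers x ≤ MulAction.stabilizer (E ≃ₐ[F] E) α :=
        Subgroup.zpowers_le.2 hxα
      exact this hf

/-- By Hilbert's Theorem 90, cocycle steps come from radical extensions. -/
theorem IsCocycleStep.isRadicalStep [FiniteDimensional F E] [IsGalois F E] [hp : Fact p.Prime]
    {ζ : E} (hζ : IsPrimitiveRoot ζ p) {V W : Subgroup (E ≃ₐ[F] E)}
    (h : IsCocycleStep (hζ.autToPow F) V W) : IsRadicalStep (fixedField W) (fixedField V) := by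
  obtain ⟨hlt, c, hc, hz⟩ := h
  have hζ0 : ζ ≠ 0 := hζ.ne_zero hp.out.ne_zero
  have hmem : ∀ g : E ≃ₐ[fixedField W] E, g.restrictScalars F ∈ W := by
    intro g
    have h : g.restrictScalars F ∈ (fixedField W).fixingSubgroup :=
      (mem_fixingSubgroup_iff _ _).2 fun x hx => g.commutes ⟨x, hx⟩
    rwa [fixingSubgroup_fixedField] at h
  -- Exponentiating to base `ζ` absorbs the twist: `ω` describes the Galois action on `ζ`, so `f` is
  -- an ordinary multiplicative cocycle.
  let f : (E ≃ₐ[fixedField W] E) → Eˣ := fun g => (Units.mk0 ζ hζ0) ^ (c (g.restrictScalars F)).val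
  have hf : groupCohomology.IsMulCocycle₁ f := by
    intro g h
    refine Units.ext ?_
    have h1 : c ((g * h).restrictScalars F) = _ := hc _ (hmem g) _ (hmem h)
    change ζ ^ (c ((g * h).restrictScalars F)).val =
      g (ζ ^ (c (h.restrictScalars F)).val) * ζ ^ (c (g.restrictScalars F)).val
    rw [h1, hζ.pow_val_add, hζ.pow_val_mul, map_pow, mul_comm, hζ.autToPow_spec F]
    rfl
  obtain ⟨β, hβ⟩ := groupCohomology.isMulCoboundary₁_of_isMulCocycle₁_of_aut_to_units f hf
  have hW : ∀ w ∈ W, w β = ζ ^ (c w).val * β := by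
    intro w hw
    let g : E ≃ₐ[fixedField W] E := subgroupEquivAlgEquiv W ⟨w, hw⟩
    have h1 := congrArg Units.val (hβ g)
    rw [Units.val_div_eq_div_val, div_eq_iff β.ne_zero] at h1
    exact h1
  refine ⟨fixedField_antitone hlt.le, β, ?_, ⟨p, hp.out.pos, ?_⟩, fun M hWM hβM => ?_⟩
  · rw [mem_fixedField_iff]
    intro v hv
    rw [hW v (hlt.le hv), (hz v (hlt.le hv)).1 hv, ZMod.val_zero, pow_zero, one_mul]
  · rw [mem_fixedField_iff]
    intro w hw
    rw [map_pow, hW w hw, mul_pow, ← pow_mul, mul_comm, pow_mul', hζ.pow_eq_one, one_pow, mul_one]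
  · rw [← IsGalois.fixedField_fixingSubgroup M]
    refine fixedField_antitone fun w hw => ?_
    have hwW : w ∈ W := by
      rw [← fixingSubgroup_fixedField W]
      exact fixingSubgroup_antitone hWM hw
    rw [hz w hwW]
    apply hζ.pow_val_inj
    apply mul_right_cancel₀ β.ne_zero
    rw [← hW w hwW, (mem_fixingSubgroup_iff M w).1 hw _ hβM, ZMod.val_zero, pow_zero, one_mul]

/-- The elements whose orbit under the automorphism `g` is finite of `p`-power length. -/
def pPowerFixedField (p : ℕ) (g : E ≃ₐ[F] E) : IntermediateField F E :=
  have hmono : ∀ (n k : ℕ) (x : E), (g ^ p ^ n) x = x → (g ^ p ^ (n + k)) x = x := by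
    intro n k x hx
    rw [pow_add, pow_mul]
    exact pow_mem (S := MulAction.stabilizer (E ≃ₐ[F] E) x) hx _
  have hpair : ∀ {x y : E}, (∃ n : ℕ, (g ^ p ^ n) x = x) → (∃ n : ℕ, (g ^ p ^ n) y = y) →
      ∃ n : ℕ, (g ^ p ^ n) x = x ∧ (g ^ p ^ n) y = y := by
    rintro x y ⟨n, hn⟩ ⟨m, hm⟩
    exact ⟨n + m, hmono n m x hn, add_comm m n ▸ hmono m n y hm⟩
  { carrier := {x | ∃ n : ℕ, (g ^ p ^ n) x = x}
    mul_mem' := fun hx hy => by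
      obtain ⟨n, h1, h2⟩ := hpair hx hy
      exact ⟨n, by rw [map_mul, h1, h2]⟩
    add_mem' := fun hx hy => by
      obtain ⟨n, h1, h2⟩ := hpair hx hy
      exact ⟨n, by rw [map_add, h1, h2]⟩
    algebraMap_mem' := fun a => ⟨0, AlgEquiv.commutes _ a⟩
    inv_mem' := fun x ⟨n, hn⟩ => ⟨n, by rw [map_inv₀, hn]⟩ }

theorem mem_pPowerFixedField {p : ℕ} {g : E ≃ₐ[F] E} {x : E} :
    x ∈ pPowerFixedField p g ↔ ∃ n : ℕ, (g ^ p ^ n) x = x :=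
  Iff.rfl

/-- An automorphism fixing the `p`-th roots of unity has orbits of `p`-power length on every field
obtained by adjoining `p`-th roots successively. -/
theorem fieldRange_le_pPowerFixedField {L : Type*} [Field L] [Algebra F L] [hp : Fact p.Prime]
    (h : ReflTransGen (IsPowStep p) (⊥ : IntermediateField F L) ⊤) {ζ : E}
    (hζ : IsPrimitiveRoot ζ p) {g : E ≃ₐ[F] E} (hg : g ζ = ζ) (ψ : L →ₐ[F] E) :
    ψ.fieldRange ≤ pPowerFixedField p g := by
  suffices ∀ B : IntermediateField F L, ReflTransGen (IsPowStep p) ⊥ B →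
      B ≤ (pPowerFixedField p g).comap ψ by
    rintro _ ⟨x, rfl⟩
    exact this ⊤ h (x := x) trivial
  intro B hB
  induction hB with
  | refl => exact bot_le
  | @tail A B _ hAB ih =>
    obtain ⟨_, α, _, hαp, hM⟩ := hAB
    refine hM _ ih ?_
    obtain ⟨n, hn⟩ := mem_pPowerFixedField.1 (ih hαp)
    refine mem_pPowerFixedField.2 ?_
    change (g ^ p ^ n) (ψ (α ^ p)) = ψ (α ^ p) at hn
    change ∃ n : ℕ, (g ^ p ^ n) (ψ α) = ψ α
    generalize g ^ p ^ n = k, hk : g ^ p ^ n = k at hn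
    have hkζ : k ζ = ζ := by
      rw [← hk]
      exact pow_mem (S := MulAction.stabilizer (E ≃ₐ[F] E) ζ) hg _
    by_cases h0 : ψ α = 0
    · exact ⟨0, by rw [h0, map_zero]⟩
    -- `k` fixes both `ζ` and `ψ α ^ p`, so it scales `ψ α` by a power of `ζ`, and `k ^ p` fixes `ψ
    -- α`.
    have h1 : (k (ψ α) / ψ α) ^ p = 1 := by
      rw [div_pow, ← map_pow, ← map_pow, hn, map_pow, div_self (pow_ne_zero _ h0)]
    obtain ⟨i, _, hi⟩ := hζ.eq_pow_of_pow_eq_one h1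
    rw [eq_div_iff h0] at hi
    have hpow : ∀ m : ℕ, (k ^ m) (ψ α) = (ζ ^ i) ^ m * ψ α := by
      intro m
      induction m with
      | zero => simp
      | succ m ihm =>
        rw [pow_succ', AlgEquiv.mul_apply, ihm, map_mul, map_pow, map_pow, hkζ, ← hi]
        ring
    refine ⟨n + 1, ?_⟩
    rw [pow_succ, pow_mul, hk, hpow, ← pow_mul, mul_comm i p, pow_mul, hζ.pow_eq_one, one_pow,
      one_mul]

/-- The elements with `p`-power orbit under `g` form a field containing `ζ` and all conjugates of
`L`, hence a primitive element of `E`; its orbit length bounds the order of `g`. -/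
theorem isPGroup_ker_autToPow [FiniteDimensional F E] [IsGalois F E] {L : Type*} [Field L] [Algebra F L]
    [hp : Fact p.Prime] (h : ReflTransGen (IsPowStep p) (⊥ : IntermediateField F L) ⊤) {ζ : E}
    (hζ : IsPrimitiveRoot ζ p)
    (hgen : ∀ S : IntermediateField F E, (∀ ψ : L →ₐ[F] E, ψ.fieldRange ≤ S) → ζ ∈ S → S = ⊤) :
    IsPGroup p (hζ.autToPow F).ker := by
  rintro ⟨g, hg⟩
  have hgζ : g ζ = ζ := by
    rw [← hζ.autToPow_spec F g, MonoidHom.mem_ker.1 hg, Units.val_one, ZMod.val_one, pow_one]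
  have htop : pPowerFixedField p g = ⊤ :=
    hgen _ (fieldRange_le_pPowerFixedField h hζ hgζ) ⟨0, by simpa using hgζ⟩
  obtain ⟨x, hx⟩ := Field.exists_primitive_element F E
  obtain ⟨n, hn⟩ := mem_pPowerFixedField.1 (htop ▸ mem_top : x ∈ pPowerFixedField p g)
  refine ⟨n, Subtype.ext ?_⟩
  have hle : F⟮x⟯ ≤ fixedField (Subgroup.zpowers (g ^ p ^ n)) := by
    rw [adjoin_le_iff, Set.singleton_subset_iff, SetLike.mem_coe, mem_fixedField_iff]
    exact fun f hf => (Subgroup.zpowers_le.2 hn :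
      _ ≤ MulAction.stabilizer (E ≃ₐ[F] E) x) hf
  rw [le_iff_le, hx, fixingSubgroup_top, Subgroup.zpowers_le] at hle
  exact Subgroup.mem_bot.1 hle

theorem IsPowStep.map {L : Type*} [Field L] [Algebra F L] (ι : L →ₐ[F] E)
    {A B : IntermediateField F L} (h : IsPowStep p A B) : IsPowStep p (A.map ι) (B.map ι) := by
  obtain ⟨hlt, α, hα, hαp, hM⟩ := h
  refine ⟨lt_of_le_of_ne (map_mono ι hlt.le) fun h => hlt.ne (map_injective ι h), ι α,
    ⟨α, hα, rfl⟩, ⟨α ^ p, hαp, map_pow ι α p⟩, fun M hAM hαM => ?_⟩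
  rw [map_le_iff_le_comap] at hAM ⊢
  exact hM _ hAM hαM

/-- The cyclotomic character maps the stabilizer of a subfield of `p`-power degree onto its whole
range. -/
theorem exists_mem_fixingSubgroup_autToPow_eq [FiniteDimensional F E] [IsGalois F E]
    [hp : Fact p.Prime] {ζ : E} (hζ : IsPrimitiveRoot ζ p) (N : IntermediateField F E) {k : ℕ}
    (hN : Module.finrank F N = p ^ k) (g : E ≃ₐ[F] E) :
    ∃ u ∈ N.fixingSubgroup, hζ.autToPow F u = hζ.autToPow F g := by
  set ω := hζ.autToPow F
  have h1 : (N.fixingSubgroup ⊔ ω.ker).index ∣ p ^ k := by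
    rw [← hN, finrank_eq_fixingSubgroup_index]
    exact Subgroup.index_dvd_of_le le_sup_left
  have h2 : (N.fixingSubgroup ⊔ ω.ker).index ∣ p - 1 := by
    refine (Subgroup.index_dvd_of_le le_sup_right).trans ?_
    rw [Subgroup.index_ker, ← ZMod.card_units p, ← Nat.card_eq_fintype_card]
    exact Subgroup.card_subgroup_dvd_card _
  have hcop : Nat.Coprime (p ^ k) (p - 1) := by
    refine Nat.Coprime.pow_left _ ?_
    rw [Nat.coprime_self_sub_right hp.out.one_le]
    exact Nat.coprime_one_right p
  have h3 := Subgroup.index_eq_one.1 (Nat.eq_one_of_dvd_coprimes hcop h1 h2)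
  obtain ⟨u, hu, x, hx, rfl⟩ := Subgroup.mem_sup_of_normal_right.1 (h3 ▸ Subgroup.mem_top g)
  exact ⟨u, hu, by rw [map_mul, MonoidHom.mem_ker.1 hx, mul_one]⟩

theorem isRepeatedRadicalExtension_of_isPowStep [FiniteDimensional F E] [IsGalois F E]
    {L : Type*} [Field L] [Algebra F L] [hp : Fact p.Prime]
    (h : ReflTransGen (IsPowStep p) (⊥ : IntermediateField F L) ⊤) {k : ℕ}
    (hk : Module.finrank F L = p ^ k) {ζ : E} (hζ : IsPrimitiveRoot ζ p) (ι : L →ₐ[F] E)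
    (hgen : ∀ S : IntermediateField F E, (∀ ψ : L →ₐ[F] E, ψ.fieldRange ≤ S) → ζ ∈ S → S = ⊤)
    (K : IntermediateField F L) : IsRepeatedRadicalExtension F K := by
  have hU : ReflTransGen (IsCocycleStep (hζ.autToPow F)) ι.fieldRange.fixingSubgroup ⊤ := by
    suffices ∀ B : IntermediateField F L, ReflTransGen (IsPowStep p) ⊥ B →
        ReflTransGen (IsCocycleStep (hζ.autToPow F)) (B.map ι).fixingSubgroup ⊤ by
      simpa [AlgHom.fieldRange_eq_map] using this ⊤ h
    intro B hB
    induction hB with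
    | refl => rw [IntermediateField.map_bot, fixingSubgroup_bot]
    | tail _ hAB ih => exact ReflTransGen.head ((hAB.map ι).isCocycleStep hζ) ih
  have hN : Module.finrank F ι.fieldRange = p ^ k := by
    rw [← hk]
    exact (AlgEquiv.ofInjectiveField ι).toLinearEquiv.finrank_eq.symm
  have hV := IsCocycleStep.reflTransGen_of_ge (isPGroup_ker_autToPow h hζ hgen)
    (exists_mem_fixingSubgroup_autToPow_eq hζ _ hN) ⊤ hU (K.map ι).fixingSubgroup
    (fixingSubgroup_antitone (by rintro _ ⟨x, _, rfl⟩; exact ⟨x, rfl⟩)) le_top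
  refine isRepeatedRadicalExtension_of_reflTransGen (ι.comp K.val) ?_
  have hR : (ι.comp K.val).fieldRange = K.map ι := by
    ext x
    constructor
    · rintro ⟨y, rfl⟩
      exact ⟨y, y.2, rfl⟩
    · rintro ⟨y, hy, rfl⟩
      exact ⟨⟨y, hy⟩, rfl⟩
  -- Fixed fields reverse the chain from the group of `K` up to `G`, giving a radical tower from `F`
  -- up to `K`.
  rw [hR, ← IsGalois.fixedField_fixingSubgroup (K.map ι)]
  generalize (K.map ι).fixingSubgroup = V at hV
  generalize hT : (⊤ : Subgroup (E ≃ₐ[F] E)) = T at hV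
  rw [← IsGalois.fixedField_top, hT]
  clear hT hU hR
  induction hV with
  | refl => exact ReflTransGen.refl
  | tail _ hVW ih => exact ReflTransGen.head (hVW.isRadicalStep hζ) ih

end KummerCocycles

/-! ### Construction of the ambient Galois extension, and the theorem. -/

open IntermediateField in
theorem IsQuasireal.isRepeatedRadicalExtension_intermediateField {F L : Type*} [Field F] [Field L]
    [Algebra F L] (hL : IsQuasireal L) (h : IsRepeatedRadicalExtension F L) {p k : ℕ}
    (hp : p.Prime) (hk : Module.finrank F L = p ^ k) (K : IntermediateField F L) :
    IsRepeatedRadicalExtension F K := by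
  -- An infinite extension would have `finrank` zero, which is not a power of `p`.
  have hfin : FiniteDimensional F L := Module.finite_of_finrank_pos (hk ▸ pow_pos hp.pos k)
  have hpf : Fact p.Prime := ⟨hp⟩
  have hcL : CharZero L := hL.1
  have hcF : CharZero F := (RingHom.charZero_iff (algebraMap F L).injective).2 hcL
  have hcΩ : CharZero (AlgebraicClosure L) :=
    (RingHom.charZero_iff (algebraMap L (AlgebraicClosure L)).injective).1 hcL
  have hnp : NeZero (p : AlgebraicClosure L) := ⟨Nat.cast_ne_zero.2 hp.ne_zero⟩
  have hAlg : Algebra.IsAlgebraic F (AlgebraicClosure L) :=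
    Algebra.IsAlgebraic.trans F L (AlgebraicClosure L)
  have hΩ : IsAlgClosure F (AlgebraicClosure L) := ⟨inferInstance, hAlg⟩
  have hnorm : Normal F (AlgebraicClosure L) := normal_iff.2 fun x =>
    ⟨Algebra.IsIntegral.isIntegral x, IsAlgClosed.splits _⟩
  obtain ⟨ζ, hζ⟩ := HasEnoughRootsOfUnity.exists_primitiveRoot (AlgebraicClosure L) p
  have hcyc := hζ.intermediateField_adjoin_isCyclotomicExtension F
  have hgalζ : IsGalois F F⟮ζ⟯ := IsCyclotomicExtension.isGalois {p} F F⟮ζ⟯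
  have hfinζ : FiniteDimensional F F⟮ζ⟯ := adjoin.finiteDimensional (hAlg.isIntegral.isIntegral ζ)
  let N := normalClosure F L (AlgebraicClosure L)
  let E : IntermediateField F (AlgebraicClosure L) := N ⊔ F⟮ζ⟯
  have hNE : ∀ ψ : L →ₐ[F] AlgebraicClosure L, ψ.fieldRange ≤ E := fun ψ =>
    (AlgHom.fieldRange_le_normalClosure ψ).trans le_sup_left
  have hζE : ζ ∈ E := (le_sup_right : F⟮ζ⟯ ≤ E) (mem_adjoin_simple_self F ζ)
  have hfinE : FiniteDimensional F E := finiteDimensional_sup N F⟮ζ⟯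
  have hnE : Normal F E := normal_sup _ _ _ _
  have hgE : IsGalois F E := { }
  have lift : ∀ ψ : L →ₐ[F] AlgebraicClosure L, ∃ ψ' : L →ₐ[F] E, E.val.comp ψ' = ψ := fun ψ =>
    ⟨ψ.codRestrict E.toSubalgebra fun x => hNE ψ ⟨x, rfl⟩, rfl⟩
  obtain ⟨ι, -⟩ := lift (IsScalarTower.toAlgHom F L (AlgebraicClosure L))
  refine isRepeatedRadicalExtension_of_isPowStep (E := E)
    (h.reflTransGen_isPowStep hL hp hk) hk (ζ := ⟨ζ, hζE⟩)
    (IsPrimitiveRoot.coe_submonoidClass_iff.1 hζ) ι (fun S hS hζS => ?_) K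
  -- The normal closure is the compositum of the images of all embeddings of `L`, each of which
  -- factors through `E`.
  have hle : E ≤ S.map E.val := by
    refine sup_le ?_ ?_
    · refine iSup_le fun ψ => ?_
      obtain ⟨ψ', rfl⟩ := lift ψ
      rintro _ ⟨x, rfl⟩
      exact ⟨ψ' x, hS ψ' ⟨x, rfl⟩, rfl⟩
    · rw [adjoin_le_iff, Set.singleton_subset_iff]
      exact ⟨⟨ζ, hζE⟩, hζS, rfl⟩
  rw [eq_top_iff]
  rintro x -
  obtain ⟨y, hy, hyx⟩ := hle x.2
  exact (Subtype.ext hyx : y = x) ▸ hy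

theorem theorem8p1 {Q L : Type*} [Field Q] [Field L] [Algebra Q L]
    (hL : IsRepeatedRadicalExtension Q L) :
    (IsQuasireal L → (∃ p k : ℕ, p.Prime ∧ Module.finrank Q L = p ^ k) →
      ∀ K : IntermediateField Q L, IsRepeatedRadicalExtension Q K) ∧
    (IsRealField L → (∃ k : ℕ, Module.finrank Q L = 2 ^ k) →
      ∀ K : IntermediateField Q L, IsRepeatedRadicalExtension Q K) := by
  constructor
  · rintro hq ⟨p, k, hp, hk⟩ K
    exact hq.isRepeatedRadicalExtension_intermediateField hL hp hk K
  · rintro hr ⟨k, hk⟩ K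
    exact hr.isQuasireal.isRepeatedRadicalExtension_intermediateField hL Nat.prime_two hk K
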